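/- Let $\Gamma$ be a metrized graph with vertex set $V$, i.e. a finite connected multigraph (multiple edges and self-loops are allowed) with vertex set $V$ in which each edge $e_i$ is a parametrized segment of length $L_i>0$ with end points $p_i,q_i$. Let $v=|V|$. View $\Gamma$ as an electric circuit in which the resistance of each edge is its length. For vertices $x,y,z$ let $j_z(x,y)$ be the voltage difference between $x$ and $z$ when unit current enters at $y$ and exits at $z$, and let $r(x,y)=j_y(x,x)$ be the effective resistance. The Kirchhoff index of $\Gamma$ is $$Kf(\Gamma)=\frac12\sum_{p,q\in V} r(p,q).$$ For an edge $e_i$ let $\Gamma-e_i$ be the graph obtained by deleting the interior of $e_i$. If $\Gamma-e_i$ is connected, let $R_i$ be the effective resistance between $p_i$ and $q_i$ in $\Gamma-e_i$, and for $p\in V$ put $R_{a_i,p}=\hat j_{p_i}(p,q_i)$ and $R_{b_i,p}=\hat j_{q_i}(p,p_i)$, where $\hat j$ is the voltage function of $\Gamma-e_i$. If $e_i$ is a bridge, put $(R_{a_i,p},R_{b_i,p})=(0,R_i)$ or $(R_i,0)$ according to whether $p$ lies in the component of $\Gamma-e_i$ containing $p_i$ or $q_i$, and take the limit $R_i\to\infty$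 in every expression involving $R_i$. For $p\in V$ put $$y(\Gamma)=\frac14\sum_{e_i}\frac{L_iR_i^2}{(L_i+R_i)^2}+\frac34\sum_{e_i}\frac{L_i(R_{a_i,p}-R_{b_i,p})^2}{(L_i+R_i)^2},$$ the sums being over all edges of $\Gamma$ (this value does not depend on $p$). **Proposition.** If $v\ge 4$, then, with $y(\Gamma)$ computed from any vertex $p\in V$, $$(v-1)\,y(\Gamma)\le Kf(\Gamma)\le \frac{v^2-3v+4}{2}\,y(\Gamma).$$ -/

import Mathlib

open Filter Topology

/-- A finite multigraph (multiple edges and self-loops allowed, connectedness not required) with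
vertex type `V` and edge type `E`. Each edge `e` is parametrized by a segment of positive length
`len e` running from `src e` to `tgt e`. -/
structure LengthGraph (V E : Type*) where
  src : E → V
  tgt : E → V
  len : E → ℝ
  len_pos : ∀ e, 0 < len e

namespace LengthGraph

variable {V E : Type*}

/-- The simple graph on `V` in which two distinct vertices are adjacent when some edge joins them;
it has the same connected components as the multigraph. -/
def skeleton (G : LengthGraph V E) : SimpleGraph V :=
  SimpleGraph.fromRel fun a b => ∃ e, G.src e = a ∧ G.tgt e = b

/-- The graph obtained by deleting the interior of the edge `e`. -/
def deleteEdge (G : LengthGraph V E) (e : E) : LengthGraph V {e' : E // e' ≠ e} where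
  src e' := G.src e'
  tgt e' := G.tgt e'
  len e' := G.len e'
  len_pos e' := G.len_pos e'

variable [Fintype E] [DecidableEq V]

/-- Regard every edge as a resistor whose resistance is its length. For vertex potentials `f`,
this is the total current that flows out of the vertex `q` along the edges (Ohm's law: the current
along an edge is the potential drop divided by the length). -/
noncomputable def outflow (G : LengthGraph V E) (f : V → ℝ) (q : V) : ℝ :=
  ∑ e, ((if G.src e = q then (f (G.src e) - f (G.tgt e)) / G.len e else 0) +
    (if G.tgt e = q then (f (G.tgt e) - f (G.src e)) / G.len e else 0))

/-- `f` is the potential, normalized to be `0` at `z`, when unit current enters at `y` and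
exits at `z` (Kirchhoff's current law at every vertex). -/
def IsPotential (G : LengthGraph V E) (z y : V) (f : V → ℝ) : Prop :=
  f z = 0 ∧ ∀ q, G.outflow f q = (if q = y then 1 else 0) - (if q = z then 1 else 0)

end LengthGraph

/-- A metrized graph together with a vertex set: a finite connected multigraph with parametrized
edges of positive length. -/
structure MetrizedGraph (V E : Type*) extends LengthGraph V E where
  connected : toLengthGraph.skeleton.Connected

namespace MetrizedGraph

variable {V E : Type*} [Fintype V] [Fintype E] [DecidableEq V]

theorem sum_mul_outflow (G : LengthGraph V E) (f g : V → ℝ) :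
    ∑ q, g q * G.outflow f q =
      ∑ e, (g (G.src e) - g (G.tgt e)) * (f (G.src e) - f (G.tgt e)) / G.len e := by
  simp only [LengthGraph.outflow, Finset.mul_sum]
  rw [Finset.sum_comm]
  refine Finset.sum_congr rfl fun e _ => ?_
  simp only [mul_add, Finset.sum_add_distrib, mul_ite, mul_zero, Finset.sum_ite_eq,
    Finset.mem_univ, if_true]
  ring

/-- A potential with no current entering or leaving away from its zero `z` vanishes. -/
theorem eq_zero_of_outflow (G : MetrizedGraph V E) (z : V) (f : V → ℝ) (hz : f z = 0)
    (hf : ∀ q, q ≠ z → G.outflow f q = 0) : f = 0 := by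
  have h0 : ∑ q, f q * G.outflow f q = 0 := by
    refine Finset.sum_eq_zero fun q _ => ?_
    by_cases hq : q = z
    · simp [hq, hz]
    · simp [hf q hq]
  rw [sum_mul_outflow] at h0
  have hnn : ∀ e ∈ Finset.univ,
      0 ≤ (f (G.src e) - f (G.tgt e)) * (f (G.src e) - f (G.tgt e)) / G.len e :=
    fun e _ => div_nonneg (mul_self_nonneg _) (G.len_pos e).le
  rw [Finset.sum_eq_zero_iff_of_nonneg hnn] at h0
  have hedge : ∀ e, f (G.src e) = f (G.tgt e) := fun e => by
    have h1 := h0 e (Finset.mem_univ e)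
    rw [div_eq_zero_iff, or_iff_left (G.len_pos e).ne', mul_self_eq_zero] at h1
    linarith
  have hwalk : ∀ a b, G.skeleton.Walk a b → f a = f b := by
    intro a b w
    induction w with
    | nil => rfl
    | cons h _ ih =>
      rw [← ih]
      rw [LengthGraph.skeleton, SimpleGraph.fromRel_adj] at h
      obtain ⟨_, ⟨e, rfl, rfl⟩ | ⟨e, rfl, rfl⟩⟩ := h
      · exact hedge e
      · exact (hedge e).symm
  funext q
  obtain ⟨w⟩ := G.connected.preconnected q z
  rw [hwalk q z w, hz]
  rfl

/-- The potential exists and is unique on a metrized graph. -/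
theorem existsUnique_potential (G : MetrizedGraph V E) (z y : V) :
    ∃! f, G.IsPotential z y f := by
  let T : (V → ℝ) →ₗ[ℝ] (V → ℝ) :=
    { toFun := fun f q => if q = z then f z else G.outflow f q
      map_add' := fun f g => by
        funext q
        simp only [Pi.add_apply]
        split_ifs
        · rfl
        · simp only [LengthGraph.outflow, ← Finset.sum_add_distrib]
          refine Finset.sum_congr rfl fun e _ => ?_
          simp only [Pi.add_apply]
          split_ifs <;> ring
      map_smul' := fun c f => by
        funext q
        simp only [Pi.smul_apply, smul_eq_mul, RingHom.id_apply]
        split_ifs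
        · rfl
        · simp only [LengthGraph.outflow, Finset.mul_sum]
          refine Finset.sum_congr rfl fun e _ => ?_
          simp only [Pi.smul_apply, smul_eq_mul]
          split_ifs <;> ring }
  have hT : ∀ f q, T f q = if q = z then f z else G.outflow f q := fun _ _ => rfl
  have hinj : Function.Injective T := by
    rw [injective_iff_map_eq_zero]
    intro f hf
    refine eq_zero_of_outflow G z f ?_ fun q hq => ?_
    · have h1 := congrFun hf z
      rw [hT, if_pos rfl] at h1
      exact h1
    · have h1 := congrFun hf q
      rw [hT, if_neg hq] at h1
      exact h1
  obtain ⟨f, hf⟩ := (LinearMap.injective_iff_surjective.mp hinj)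
    (fun q => (if q = y then 1 else 0) - (if q = z then 1 else 0) +
      (if q = z then 1 - (if z = y then 1 else 0) else 0))
  have hfz : f z = 0 := by
    have h1 := congrFun hf z
    rw [hT, if_pos rfl] at h1
    rw [h1]
    simp
  have hfq : ∀ q, q ≠ z → G.outflow f q = (if q = y then 1 else 0) - (if q = z then 1 else 0) := by
    intro q hq
    have h1 := congrFun hf q
    rw [hT, if_neg hq] at h1
    rw [h1]
    simp [hq]
  have hsum : ∑ q, (G.outflow f q - ((if q = y then 1 else 0) - (if q = z then 1 else 0))) = 0 := by
    have h1 := sum_mul_outflow G.toLengthGraph f (fun _ => 1)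
    simp only [one_mul, sub_self, zero_mul, zero_div, Finset.sum_const_zero] at h1
    rw [Finset.sum_sub_distrib, Finset.sum_sub_distrib, h1]
    simp
  refine ⟨f, ⟨hfz, fun q => ?_⟩, fun g hg => ?_⟩
  · by_cases hq : q = z
    · rw [Finset.sum_eq_single z (fun q _ hq => by rw [hfq q hq, sub_self])
        (fun h => absurd (Finset.mem_univ z) h)] at hsum
      rw [hq]
      linarith
    · exact hfq q hq
  · apply hinj
    funext q
    rw [hT, hT]
    by_cases hq : q = z
    · rw [if_pos hq, if_pos hq, hg.1, hfz]
    · rw [if_neg hq, if_neg hq, hg.2 q, hfq q hq]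

/-- The voltage function `j_z(x, y)`: the potential at `x`, relative to the potential `0` at `z`,
when unit current enters at `y` and exits at `z`. -/
noncomputable def voltage (G : MetrizedGraph V E) (z x y : V) : ℝ :=
  (existsUnique_potential G z y).exists.choose x

/-- The effective resistance `r(x, y) = j_y(x, x)`. -/
noncomputable def resistance (G : MetrizedGraph V E) (x y : V) : ℝ :=
  G.voltage y x x

/-- The Kirchhoff index. -/
noncomputable def kirchhoffIndex (G : MetrizedGraph V E) : ℝ :=
  (1 / 2) * ∑ p, ∑ q, G.resistance p q

/-- The contribution to `y` of an edge of length `L` with values `R = R_i`, `Ra = R_{a_i,p}`,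
`Rb = R_{b_i,p}`. -/
noncomputable def yTerm (L R Ra Rb : ℝ) : ℝ :=
  (1 / 4) * (L * R ^ 2 / (L + R) ^ 2) + (3 / 4) * (L * (Ra - Rb) ^ 2 / (L + R) ^ 2)

variable [DecidableEq E]

open Classical in
/-- The contribution of the edge `e` to `y`, with respect to the vertex `p`. If `G - e` is
connected, then `R_i` is the resistance between the end points of `e` in `G - e`, and
`R_{a_i,p}`, `R_{b_i,p}` are voltages in `G - e`. If `e` is a bridge, then
`(R_{a_i,p}, R_{b_i,p})` is `(0, R_i)` or `(R_i, 0)` according to the component of `G - e`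
that contains `p`, and the limit `R_i → ∞` is taken. -/
noncomputable def yEdge (G : MetrizedGraph V E) (p : V) (e : E) : ℝ :=
  if h : (G.deleteEdge e).skeleton.Connected then
    let G' : MetrizedGraph V {e' : E // e' ≠ e} := ⟨G.deleteEdge e, h⟩
    yTerm (G.len e) (G'.resistance (G.src e) (G.tgt e))
      (G'.voltage (G.src e) p (G.tgt e)) (G'.voltage (G.tgt e) p (G.src e))
  else if (G.deleteEdge e).skeleton.Reachable p (G.src e) then
    limUnder atTop fun R : ℝ => yTerm (G.len e) R 0 R
  else
    limUnder atTop fun R : ℝ => yTerm (G.len e) R R 0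

/-- The invariant `y(G)`, computed with respect to the vertex `p`. -/
noncomputable def yInvariant (G : MetrizedGraph V E) (p : V) : ℝ :=
  ∑ e, G.yEdge p e

/-- The two limits used for bridges exist and equal the length of the bridge. -/
theorem tendsto_yTerm (L : ℝ) :
    Tendsto (fun R : ℝ => yTerm L R 0 R) atTop (𝓝 L) ∧
      Tendsto (fun R : ℝ => yTerm L R R 0) atTop (𝓝 L) := by
  have h1 : Tendsto (fun R : ℝ => L * (1 - L * (L + R)⁻¹) ^ 2) atTop (𝓝 L) := by
    have h2 : Tendsto (fun R : ℝ => (L + R)⁻¹) atTop (𝓝 0) :=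
      tendsto_inv_atTop_zero.comp (tendsto_atTop_add_const_left atTop L tendsto_id)
    have h3 := (((h2.const_mul L).const_sub 1).pow 2).const_mul L
    simpa using h3
  have h4 : ∀ᶠ R : ℝ in atTop, L + R ≠ 0 := by
    filter_upwards [eventually_gt_atTop (-L)] with R hR
    linarith
  constructor <;>
  · refine h1.congr' ?_
    filter_upwards [h4] with R hR
    rw [yTerm]
    field_simp
    ring

end MetrizedGraph

/-! ### Edge deletion and linearity of the current. -/

namespace LengthGraph

variable {V E : Type*}

/-! Both invariants are sums over edges of expressions in one function. For an edge of length L from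
a to b let x be the potential with x b = 0 for unit current from a to b, and r = x a. Energy and
reciprocity give Kf = ∑ D / L, where D = 1/2 ∑ (x p - x q)² over p, q (`kirchhoffIndex_eq`).
Parallel reduction turns y into ∑ (r² + 3 (r - 2 x p)²) / (4L), bridges included (`yEdge_eq`); as it
does not depend on p, it may be averaged over all n vertices (`card_mul_yInvariant`). Both bounds
then hold edge by edge, using 0 ≤ x ≤ r, and for the lower one also that x attains 0 and r. The
upper argument yields the sharper Kf ≤ (n²/4) y. -/

theorem deleteEdge_reachable (G : LengthGraph V E) {e e' : E} (h : e' ≠ e) :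
    (G.deleteEdge e).skeleton.Reachable (G.src e') (G.tgt e') := by
  by_cases hne : G.src e' = G.tgt e'
  · rw [hne]
  · refine SimpleGraph.Adj.reachable ?_
    rw [skeleton, SimpleGraph.fromRel_adj]
    exact ⟨hne, Or.inl ⟨⟨e', h⟩, rfl, rfl⟩⟩

/-- Deleting an edge whose end points stay connected keeps the graph connected. -/
theorem deleteEdge_connected (G : LengthGraph V E) (hG : G.skeleton.Connected) {e : E}
    (h : (G.deleteEdge e).skeleton.Reachable (G.src e) (G.tgt e)) :
    (G.deleteEdge e).skeleton.Connected := by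
  have hedge : ∀ e', (G.deleteEdge e).skeleton.Reachable (G.src e') (G.tgt e') := fun e' => by
    by_cases he : e' = e
    · rw [he]; exact h
    · exact deleteEdge_reachable G he
  have hwalk : ∀ a b, G.skeleton.Walk a b → (G.deleteEdge e).skeleton.Reachable a b := by
    intro a b w
    induction w with
    | nil => rfl
    | cons h _ ih =>
      refine SimpleGraph.Reachable.trans ?_ ih
      rw [skeleton, SimpleGraph.fromRel_adj] at h
      obtain ⟨_, ⟨e', rfl, rfl⟩ | ⟨e', rfl, rfl⟩⟩ := h
      · exact hedge e'
      · exact (hedge e').symm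
  have := hG.nonempty
  refine ⟨fun a b => ?_⟩
  obtain ⟨w⟩ := hG.preconnected a b
  exact hwalk a b w

variable [Fintype E] [DecidableEq V]

theorem outflow_sub (G : LengthGraph V E) (f g : V → ℝ) (q : V) :
    G.outflow (fun x => f x - g x) q = G.outflow f q - G.outflow g q := by
  simp only [outflow, ← Finset.sum_sub_distrib]
  refine Finset.sum_congr rfl fun e _ => ?_
  split_ifs <;> ring

theorem outflow_sub_const (G : LengthGraph V E) (f : V → ℝ) (c : ℝ) (q : V) :
    G.outflow (fun x => f x - c) q = G.outflow f q := by
  simp only [outflow, sub_sub_sub_cancel_right]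

theorem outflow_mul_const (G : LengthGraph V E) (f : V → ℝ) (c : ℝ) (q : V) :
    G.outflow (fun x => f x * c) q = G.outflow f q * c := by
  simp only [outflow, Finset.sum_mul]
  refine Finset.sum_congr rfl fun e _ => ?_
  split_ifs <;> ring

theorem outflow_eq_deleteEdge [DecidableEq E] (G : LengthGraph V E) (e : E) (f : V → ℝ) (q : V) :
    G.outflow f q = (f (G.src e) - f (G.tgt e)) / G.len e *
      ((if q = G.src e then 1 else 0) - (if q = G.tgt e then 1 else 0)) +
      (G.deleteEdge e).outflow f q := by
  rw [outflow, Fintype.sum_eq_add_sum_subtype_ne _ e]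
  congr 1
  simp only [eq_comm (a := q)]
  split_ifs <;> ring

end LengthGraph

namespace MetrizedGraph

open LengthGraph

variable {V E : Type*} [Fintype V] [Fintype E] [DecidableEq V]

/-! ### Voltages: reciprocity, superposition, energy, minimum principle. -/

theorem isPotential_voltage (G : MetrizedGraph V E) (z y : V) :
    G.IsPotential z y (fun x => G.voltage z x y) :=
  (existsUnique_potential G z y).exists.choose_spec

theorem voltage_self (G : MetrizedGraph V E) (z y : V) : G.voltage z z y = 0 :=
  (G.isPotential_voltage z y).1

theorem outflow_voltage (G : MetrizedGraph V E) (z y q : V) :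
    G.outflow (fun x => G.voltage z x y) q =
      (if q = y then 1 else 0) - (if q = z then 1 else 0) :=
  (G.isPotential_voltage z y).2 q

theorem voltage_eq_of_isPotential (G : MetrizedGraph V E) {z y : V} {f : V → ℝ}
    (hf : G.IsPotential z y f) (x : V) : G.voltage z x y = f x :=
  congrFun ((existsUnique_potential G z y).unique (G.isPotential_voltage z y) hf) x

/-- Pairing a function with the current of a voltage function evaluates a difference. -/
theorem sum_mul_voltage (G : MetrizedGraph V E) (g : V → ℝ) (z y : V) :
    ∑ e, (g (G.src e) - g (G.tgt e)) * (G.voltage z (G.src e) y - G.voltage z (G.tgt e) y) /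
      G.len e = g y - g z := by
  have h := sum_mul_outflow G.toLengthGraph (fun x => G.voltage z x y) g
  rw [← h]
  simp [outflow_voltage, mul_sub, Finset.sum_sub_distrib]

/-- Reciprocity for voltage differences. -/
theorem voltage_sub_reciprocity (G : MetrizedGraph V E) (z y w x : V) :
    G.voltage z x y - G.voltage z w y = G.voltage w y x - G.voltage w z x := by
  rw [← G.sum_mul_voltage (fun s => G.voltage z s y) w x,
    ← G.sum_mul_voltage (fun s => G.voltage w s x) z y]
  exact Finset.sum_congr rfl fun e _ => by ring

theorem voltage_comm (G : MetrizedGraph V E) (z x y : V) :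
    G.voltage z x y = G.voltage z y x := by
  have h := G.voltage_sub_reciprocity z y z x
  rwa [voltage_self, voltage_self, sub_zero, sub_zero] at h

/-- Change of the vertex at which voltages vanish. -/
theorem voltage_eq_sub (G : MetrizedGraph V E) (p b x a : V) :
    G.voltage b x a = G.voltage p x a - G.voltage p x b -
      (G.voltage p b a - G.voltage p b b) := by
  refine G.voltage_eq_of_isPotential
    (f := fun x => G.voltage p x a - G.voltage p x b - (G.voltage p b a - G.voltage p b b))
    ⟨sub_self _, fun q => ?_⟩ x
  rw [outflow_sub_const _ (fun x => G.voltage p x a - G.voltage p x b), outflow_sub,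
    outflow_voltage, outflow_voltage]
  ring

theorem resistance_comm (G : MetrizedGraph V E) (x y : V) :
    G.resistance x y = G.resistance y x := by
  have h := G.voltage_eq_sub x y x x
  rw [voltage_self, voltage_self, voltage_comm G x y x, voltage_self] at h
  rw [resistance, resistance, h]
  ring

theorem voltage_swap (G : MetrizedGraph V E) (a b x : V) :
    G.voltage a x b = G.resistance a b - G.voltage b x a := by
  have h := G.voltage_eq_sub b a x b
  rw [h, resistance, voltage_comm G b a b]
  simp only [G.voltage_comm b _ b, voltage_self]
  ring

theorem resistance_sub_resistance (G : MetrizedGraph V E) (a b p : V) :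
    G.resistance a p - G.resistance b p = G.resistance a b - 2 * G.voltage b p a := by
  have h1 := G.voltage_eq_sub p b p a
  have h2 := G.voltage_eq_sub p b a a
  rw [voltage_self, voltage_self] at h1
  rw [resistance, resistance, resistance, h1, h2, G.voltage_comm p a b]
  ring

/-- The effective resistance as an energy. -/
theorem resistance_eq_sum (G : MetrizedGraph V E) (p q : V) :
    G.resistance p q = ∑ e, (G.voltage (G.tgt e) p (G.src e) -
      G.voltage (G.tgt e) q (G.src e)) ^ 2 / G.len e := by
  have h := G.sum_mul_voltage (fun x => G.voltage q x p) q p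
  rw [voltage_self, sub_zero] at h
  rw [resistance, ← h]
  refine Finset.sum_congr rfl fun e _ => ?_
  rw [G.voltage_sub_reciprocity (G.tgt e) (G.src e) q p, sq]

theorem resistance_nonneg (G : MetrizedGraph V E) (p q : V) : 0 ≤ G.resistance p q := by
  rw [resistance_eq_sum]
  exact Finset.sum_nonneg fun e _ => div_nonneg (sq_nonneg _) (G.len_pos e).le

/-- Minimum principle: the negative part g vanishes at z and y, so its pairing with the current is
0, while that pairing dominates the energy of g. Hence g is constant along edges. -/
theorem voltage_nonneg (G : MetrizedGraph V E) (z x y : V) : 0 ≤ G.voltage z x y := by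
  set g : V → ℝ := fun s => min (G.voltage z s y) 0 with hg
  have hz : g z = 0 := by simp [hg, voltage_self]
  have hy : g y = 0 := min_eq_right (G.resistance_nonneg y z)
  have h := G.sum_mul_voltage g z y
  rw [hz, hy, sub_zero] at h
  have key : ∀ s t : ℝ, (min s 0 - min t 0) ^ 2 ≤ (min s 0 - min t 0) * (s - t) := by
    intro s t
    rcases le_total s 0 with hs | hs <;> rcases le_total t 0 with ht | ht <;>
      simp only [min_eq_left, min_eq_right, hs, ht] <;> nlinarith
  have hnn : ∀ e ∈ Finset.univ, 0 ≤ (g (G.src e) - g (G.tgt e)) *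
      (G.voltage z (G.src e) y - G.voltage z (G.tgt e) y) / G.len e := fun e _ =>
    div_nonneg ((sq_nonneg _).trans (key _ _)) (G.len_pos e).le
  rw [Finset.sum_eq_zero_iff_of_nonneg hnn] at h
  have hedge : ∀ e, g (G.src e) - g (G.tgt e) = 0 := fun e => by
    have h1 := h e (Finset.mem_univ e)
    rw [div_eq_zero_iff, or_iff_left (G.len_pos e).ne'] at h1
    have h2 := key (G.voltage z (G.src e) y) (G.voltage z (G.tgt e) y)
    exact pow_eq_zero_iff two_ne_zero |>.mp (le_antisymm (h2.trans_eq h1) (sq_nonneg _))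
  have hx := G.sum_mul_voltage g z x
  simp only [hedge, zero_mul, zero_div, Finset.sum_const_zero, hz, sub_zero] at hx
  rw [hx]
  exact min_le_left _ _

theorem voltage_le_resistance (G : MetrizedGraph V E) (a b x : V) :
    G.voltage b x a ≤ G.resistance a b := by
  have h := G.voltage_nonneg a x b
  rw [voltage_swap] at h
  linarith

/-- This is the independence of y from p. Factor the difference of squares: one factor is, by
reciprocity, a drop of the voltage between p and q; the other is a drop of s ↦ r(s,p) + r(s,q),
which has equal values at p and q, so the pairing is 0. -/
theorem sum_resistance_sub_two_mul_voltage_sq (G : MetrizedGraph V E) (p q : V) :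
    ∑ e, (G.resistance (G.src e) (G.tgt e) - 2 * G.voltage (G.tgt e) p (G.src e)) ^ 2 / G.len e =
      ∑ e, (G.resistance (G.src e) (G.tgt e) - 2 * G.voltage (G.tgt e) q (G.src e)) ^ 2 /
        G.len e := by
  have h := G.sum_mul_voltage (fun s => G.resistance s p + G.resistance s q) q p
  have hp : ∀ s, G.resistance s s = 0 := fun s => G.voltage_self s s
  rw [hp, hp, G.resistance_comm q p] at h
  rw [← sub_eq_zero, ← Finset.sum_sub_distrib]
  have h' : (-2) * (∑ e, (G.resistance (G.src e) p + G.resistance (G.src e) q -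
      (G.resistance (G.tgt e) p + G.resistance (G.tgt e) q)) *
      (G.voltage q (G.src e) p - G.voltage q (G.tgt e) p) / G.len e) = 0 := by
    rw [h]; ring
  rw [← h', Finset.mul_sum]
  refine Finset.sum_congr rfl fun e _ => ?_
  have h1 := G.resistance_sub_resistance (G.src e) (G.tgt e) p
  have h2 := G.resistance_sub_resistance (G.src e) (G.tgt e) q
  have h3 := G.voltage_sub_reciprocity (G.tgt e) (G.src e) q p
  rw [← h3, add_sub_add_comm, h1, h2]
  ring

/-! ### Edge contributions to y through voltages of the whole graph. -/

section yInvariant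

variable [DecidableEq E]

/-- The edge lies in parallel with the rest, which receives the share L / (L + R) of the unit
current; its potential scales accordingly. -/
theorem voltage_deleteEdge (G : MetrizedGraph V E) (e : E)
    (G' : MetrizedGraph V {e' : E // e' ≠ e}) (h : G'.toLengthGraph = G.deleteEdge e) (q : V) :
    G.voltage (G.tgt e) q (G.src e) = G'.voltage (G.tgt e) q (G.src e) *
      (G.len e / (G.len e + G'.resistance (G.src e) (G.tgt e))) := by
  have hL := G.len_pos e
  have hR := G'.resistance_nonneg (G.src e) (G.tgt e)
  refine G.voltage_eq_of_isPotential (f := fun q => G'.voltage (G.tgt e) q (G.src e) *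
      (G.len e / (G.len e + G'.resistance (G.src e) (G.tgt e)))) ⟨?_, fun s => ?_⟩ q
  · simp only [voltage_self, zero_mul]
  · rw [outflow_mul_const _ (fun q => G'.voltage (G.tgt e) q (G.src e)),
      outflow_eq_deleteEdge _ e, ← h, outflow_voltage, voltage_self, sub_zero]
    change (G'.resistance (G.src e) (G.tgt e) / _ * _ + _) * _ = _
    field_simp
    ring

/-- A bridge carries all the current, so the potential is constant on each side. -/
theorem voltage_of_not_connected (G : MetrizedGraph V E) (e : E)
    (h : ¬ (G.deleteEdge e).skeleton.Connected) (q : V) :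
    G.voltage (G.tgt e) q (G.src e) =
      open Classical in if (G.deleteEdge e).skeleton.Reachable q (G.src e) then G.len e else 0 := by
  classical
  have hL := G.len_pos e
  have hb : ¬ (G.deleteEdge e).skeleton.Reachable (G.tgt e) (G.src e) := fun hr =>
    h (G.deleteEdge_connected G.connected hr.symm)
  rw [G.voltage_eq_of_isPotential (f := fun q =>
    if (G.deleteEdge e).skeleton.Reachable q (G.src e) then G.len e else 0) ⟨if_neg hb, fun s => ?_⟩ q]
  have h0 : (G.deleteEdge e).outflow (fun q =>
      if (G.deleteEdge e).skeleton.Reachable q (G.src e) then G.len e else 0) s = 0 := by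
    refine Finset.sum_eq_zero fun e' _ => ?_
    have hr := G.deleteEdge_reachable e'.2
    have hiff : (G.deleteEdge e).skeleton.Reachable ((G.deleteEdge e).src e') (G.src e) ↔
        (G.deleteEdge e).skeleton.Reachable ((G.deleteEdge e).tgt e') (G.src e) :=
      ⟨hr.symm.trans, hr.trans⟩
    simp [hiff]
  rw [outflow_eq_deleteEdge _ e, h0, if_pos (SimpleGraph.Reachable.refl _), if_neg hb, sub_zero,
    div_self hL.ne', one_mul, add_zero]

/-- The contribution of an edge to `y` in terms of voltages of the whole graph. -/
theorem yEdge_eq (G : MetrizedGraph V E) (p : V) (e : E) :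
    G.yEdge p e = (1 / 4) * (G.resistance (G.src e) (G.tgt e) ^ 2 / G.len e) +
      (3 / 4) * ((G.resistance (G.src e) (G.tgt e) -
        2 * G.voltage (G.tgt e) p (G.src e)) ^ 2 / G.len e) := by
  have hL := G.len_pos e
  rw [yEdge]
  split_ifs with h hr
  · set G' : MetrizedGraph V {e' : E // e' ≠ e} := ⟨G.deleteEdge e, h⟩
    change yTerm _ _ _ _ = _
    have hR := G'.resistance_nonneg (G.src e) (G.tgt e)
    have hres : G.resistance (G.src e) (G.tgt e) = G'.resistance (G.src e) (G.tgt e) *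
      (G.len e / (G.len e + G'.resistance (G.src e) (G.tgt e))) :=
      G.voltage_deleteEdge e G' rfl (G.src e)
    rw [hres, G.voltage_deleteEdge e G' rfl p, G'.voltage_swap (G.src e) (G.tgt e) p, yTerm]
    field_simp
    ring
  · have hres : G.resistance (G.src e) (G.tgt e) = G.len e := by
      rw [resistance, voltage_of_not_connected _ _ h, if_pos (SimpleGraph.Reachable.refl _)]
    rw [(tendsto_yTerm _).1.limUnder_eq, hres, voltage_of_not_connected _ _ h, if_pos hr]
    field_simp
    ring
  · have hres : G.resistance (G.src e) (G.tgt e) = G.len e := by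
      rw [resistance, voltage_of_not_connected _ _ h, if_pos (SimpleGraph.Reachable.refl _)]
    rw [(tendsto_yTerm _).2.limUnder_eq, hres, voltage_of_not_connected _ _ h, if_neg hr]
    field_simp
    ring

end yInvariant

/-! ### Variance inequalities for a single edge. -/

theorem sum_sum_sub_sq {V : Type*} [Fintype V] (x : V → ℝ) :
    ∑ p, ∑ q, (x p - x q) ^ 2 =
      2 * (Fintype.card V * ∑ p, x p ^ 2 - (∑ p, x p) ^ 2) := by
  simp only [sub_sq, Finset.sum_add_distrib, Finset.sum_sub_distrib, Finset.sum_const,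
    Finset.card_univ, nsmul_eq_mul, ← Finset.mul_sum, ← Finset.sum_mul]
  ring

/-- Popoviciu's variance bound: x² ≤ r x, then complete the square in ∑ x. -/
theorem card_mul_sum_sq_le {V : Type*} [Fintype V] (x : V → ℝ) (r : ℝ) (h0 : ∀ p, 0 ≤ x p) (hr : ∀ p, x p ≤ r) :
    4 * (1 / 2 * ∑ p, ∑ q, (x p - x q) ^ 2) ≤ (Fintype.card V : ℝ) ^ 2 * r ^ 2 := by
  have h1 : ∑ p, x p ^ 2 ≤ r * ∑ p, x p := by
    rw [Finset.mul_sum]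
    exact Finset.sum_le_sum fun p _ => by nlinarith [h0 p, hr p]
  have h2 := mul_le_mul_of_nonneg_left h1 (Nat.cast_nonneg (α := ℝ) (Fintype.card V))
  rw [sum_sum_sub_sq]
  nlinarith [sq_nonneg ((Fintype.card V : ℝ) * r - 2 * ∑ p, x p)]

theorem sum_sum_sub_sq_eq {V : Type*} [Fintype V] (x : V → ℝ) (r : ℝ) :
    4 * (1 / 2 * ∑ p, ∑ q, (x p - x q) ^ 2) =
      Fintype.card V * ∑ p, (r - 2 * x p) ^ 2 - (∑ p, (r - 2 * x p)) ^ 2 := by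
  have h := sum_sum_sub_sq (fun p => r - 2 * x p)
  have h' : ∑ p, ∑ q, ((r - 2 * x p) - (r - 2 * x q)) ^ 2 = 4 * ∑ p, ∑ q, (x p - x q) ^ 2 := by
    simp only [Finset.mul_sum]
    exact Finset.sum_congr rfl fun p _ => Finset.sum_congr rfl fun q _ => by ring
  rw [h'] at h
  linarith

/-- The lower bound for one edge. With t = r - 2x, the sum S and square sum Q of t over the vertices
other than a, b satisfy S² ≤ (n-2) Q and |S| ≤ (n-2) r, which suffices. -/
theorem le_sum_sum_sub_sq (hv : 4 ≤ Fintype.card V) (x : V → ℝ) (r : ℝ) (a b : V)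
    (ha : x a = r) (hb : x b = 0) (h0 : ∀ p, 0 ≤ x p) (hr : ∀ p, x p ≤ r) :
    ((Fintype.card V : ℝ) - 1) * (Fintype.card V * r ^ 2 + 3 * ∑ p, (r - 2 * x p) ^ 2) ≤
      Fintype.card V * (4 * (1 / 2 * ∑ p, ∑ q, (x p - x q) ^ 2)) := by
  rw [sum_sum_sub_sq_eq x r]
  have hr0 : 0 ≤ r := ha ▸ h0 a
  rcases hr0.eq_or_lt with rfl | hpos
  · have hx : ∀ p, x p = 0 := fun p => le_antisymm (hr p) (h0 p)
    simp [hx]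
  have hab : a ≠ b := by
    rintro rfl
    linarith
  set n : ℝ := (Fintype.card V : ℝ) with hn
  have hn4 : 4 ≤ n := by rw [hn]; exact_mod_cast hv
  set s : Finset V := (Finset.univ.erase a).erase b with hs
  have hb' : b ∈ Finset.univ.erase a := by simp [hab.symm]
  have hsplit : ∀ f : V → ℝ, ∑ p, f p = f a + f b + ∑ p ∈ s, f p := fun f => by
    rw [← Finset.add_sum_erase _ f (Finset.mem_univ a), ← Finset.add_sum_erase _ f hb', add_assoc]
  have hcard : (s.card : ℝ) = n - 2 := by
    have h := hsplit (fun _ => 1)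
    simp only [Finset.sum_const, Finset.card_univ, nsmul_eq_mul, mul_one] at h
    linarith
  -- Here t is -r at a and r at b: these cancel in the sum and add 2r² to the squares.
  rw [hsplit, hsplit, ha, hb]
  have hcs := sq_sum_le_card_mul_sum_sq (s := s) (f := fun p => r - 2 * x p)
  have hup : ∑ p ∈ s, (r - 2 * x p) ≤ (n - 2) * r := by
    rw [← hcard, ← nsmul_eq_mul]
    exact Finset.sum_le_card_nsmul _ _ _ fun p _ => by linarith [h0 p]
  have hlo : (n - 2) * -r ≤ ∑ p ∈ s, (r - 2 * x p) := by
    rw [← hcard, ← nsmul_eq_mul]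
    exact Finset.card_nsmul_le_sum _ _ _ fun p _ => by linarith [hr p]
  rw [hcard] at hcs
  generalize ∑ p ∈ s, (r - 2 * x p) = S at *
  generalize ∑ p ∈ s, (r - 2 * x p) ^ 2 = Q at *
  have hS : S ^ 2 ≤ ((n - 2) * r) ^ 2 := sq_le_sq' (by linarith) hup
  have hn2 : 0 < n - 2 := by linarith
  -- after multiplying by `n - 2`, the difference is a combination of `hcs` and `hS`
  have hq : 0 ≤ n ^ 2 - 3 * n + 3 := by nlinarith
  have e1 := mul_nonneg hq (sub_nonneg.2 hcs)
  have e2 := mul_nonneg (show 0 ≤ n - 3 by linarith) (sub_nonneg.2 hS)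
  refine sub_nonneg.1 (nonneg_of_mul_nonneg_right (a := n - 2) ?_ hn2)
  nlinarith [e1, e2]

/-! ### Summation over edges and the two bounds. -/

theorem kirchhoffIndex_eq (G : MetrizedGraph V E) :
    G.kirchhoffIndex = ∑ e, (1 / 2 * ∑ p, ∑ q, (G.voltage (G.tgt e) p (G.src e) -
      G.voltage (G.tgt e) q (G.src e)) ^ 2) / G.len e := by
  simp only [kirchhoffIndex, resistance_eq_sum, mul_div_assoc, Finset.sum_div, ← Finset.mul_sum]
  congr 1
  rw [Finset.sum_comm (γ := E)]
  exact Finset.sum_congr rfl fun p _ => Finset.sum_comm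

variable [DecidableEq E]

theorem card_mul_yInvariant (G : MetrizedGraph V E) (p : V) :
    4 * (Fintype.card V * G.yInvariant p) =
      ∑ e, ((Fintype.card V : ℝ) * G.resistance (G.src e) (G.tgt e) ^ 2 +
        3 * ∑ q, (G.resistance (G.src e) (G.tgt e) -
          2 * G.voltage (G.tgt e) q (G.src e)) ^ 2) / G.len e := by
  have h : ∑ q : V, ∑ e, (G.resistance (G.src e) (G.tgt e) -
      2 * G.voltage (G.tgt e) q (G.src e)) ^ 2 / G.len e = (Fintype.card V : ℝ) *
      ∑ e, (G.resistance (G.src e) (G.tgt e) -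
        2 * G.voltage (G.tgt e) p (G.src e)) ^ 2 / G.len e := by
    rw [Finset.sum_congr rfl fun q _ => G.sum_resistance_sub_two_mul_voltage_sq q p]
    simp
  rw [Finset.sum_comm] at h
  simp only [yInvariant, yEdge_eq, add_div, mul_div_assoc, Finset.sum_add_distrib,
    ← Finset.mul_sum, Finset.sum_div, h]
  ring

end MetrizedGraph

open MetrizedGraph in
theorem mainTheorem7 {V E : Type*} [Fintype V] [Fintype E] [DecidableEq V] [DecidableEq E]
    (G : MetrizedGraph V E) (p : V) (hv : 4 ≤ Fintype.card V) :
    ((Fintype.card V : ℝ) - 1) * G.yInvariant p ≤ G.kirchhoffIndex ∧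
      G.kirchhoffIndex ≤
        ((Fintype.card V : ℝ) ^ 2 - 3 * (Fintype.card V : ℝ) + 4) / 2 * G.yInvariant p := by
  have hn4 : (4 : ℝ) ≤ Fintype.card V := by exact_mod_cast hv
  have hy := G.card_mul_yInvariant p
  have hK := G.kirchhoffIndex_eq
  have lower : ((Fintype.card V : ℝ) - 1) * (4 * (Fintype.card V * G.yInvariant p)) ≤
      4 * Fintype.card V * G.kirchhoffIndex := by
    rw [hy, hK, Finset.mul_sum, Finset.mul_sum]
    refine Finset.sum_le_sum fun e _ => ?_
    rw [← mul_div_assoc, ← mul_div_assoc]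
    refine div_le_div_of_nonneg_right ?_ (G.len_pos e).le
    refine (le_sum_sum_sub_sq hv (fun q => G.voltage (G.tgt e) q (G.src e)) _ (G.src e) (G.tgt e)
      rfl (G.voltage_self _ _) (fun q => G.voltage_nonneg _ _ _)
      fun q => G.voltage_le_resistance _ _ _).trans_eq ?_
    ring
  -- Per edge, split 16 D = 4 D + 3 · 4 D: the first part is at most n² r² (`h1`), and 4 D is at
  -- most n ∑ (r - 2x)² (`h2`, `h3`).
  have upper : 16 * G.kirchhoffIndex ≤
      (Fintype.card V : ℝ) * (4 * (Fintype.card V * G.yInvariant p)) := by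
    rw [hy, hK, Finset.mul_sum, Finset.mul_sum]
    refine Finset.sum_le_sum fun e _ => ?_
    rw [← mul_div_assoc, ← mul_div_assoc]
    refine div_le_div_of_nonneg_right ?_ (G.len_pos e).le
    have h1 := card_mul_sum_sq_le (fun q => G.voltage (G.tgt e) q (G.src e))
      (G.resistance (G.src e) (G.tgt e)) (fun q => G.voltage_nonneg _ _ _)
      fun q => G.voltage_le_resistance _ _ _
    have h2 := sum_sum_sub_sq_eq (fun q => G.voltage (G.tgt e) q (G.src e))
      (G.resistance (G.src e) (G.tgt e))
    have h3 := sq_nonneg (∑ q, (G.resistance (G.src e) (G.tgt e) -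
      2 * G.voltage (G.tgt e) q (G.src e)))
    linarith
  have hK0 : 0 ≤ G.kirchhoffIndex := by
    rw [kirchhoffIndex]
    exact mul_nonneg (by norm_num) (Finset.sum_nonneg fun a _ => Finset.sum_nonneg fun b _ =>
      G.resistance_nonneg a b)
  generalize G.kirchhoffIndex = K at *
  generalize G.yInvariant p = y at *
  generalize (Fintype.card V : ℝ) = n at *
  have hy0 : 0 ≤ y := by
    refine nonneg_of_mul_nonneg_right (a := n ^ 2) ?_ (by positivity)
    nlinarith
  constructor
  · refine le_of_mul_le_mul_left (a := 4 * n) ?_ (by linarith)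
    linarith
  -- n²/4 ≤ (n² - 3n + 4)/2 amounts to (n-4)(n-2) ≥ 0.
  · have h := mul_nonneg (mul_nonneg (sub_nonneg.2 hn4) (show 0 ≤ n - 2 by linarith)) hy0
    nlinarith
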